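/- Let $\mathcal H$ be a real Hilbert space and let $f:\mathcal H\to\mathbb R$ be convex and continuously differentiable, with $\operatorname{argmin}_{\mathcal H} f\neq\emptyset$. Let $\alpha\in\mathbb R$ and $t_0>0$, and let $u:[t_0,+\infty[\,\to\mathcal H$ be any classical (that is, $\mathcal C^3$) solution of $$\dddot u(t)+\frac{\alpha+7}{t}\ddot u(t)+\frac{5(\alpha+1)}{t^2}\dot u(t)+\nabla f\Big(u(t)+\frac14 t\,\dot u(t)\Big)=0,\qquad t\ge t_0. \tag{TOGES-V}$$ a) If $\alpha\ge 3$, then, as $t\to+\infty$, - (i) $f\big(u(t)+\frac14 t\,\dot u(t)\big)-\inf_{\mathcal H}f=\mathcal O\big(1/t^3\big)$; - (ii) $f(u(t))-\inf_{\mathcal H}f=\mathcal O\big(1/t^3\big)$. b) If $\alpha>3$, then, as $t\to+\infty$, - (iii) $f\big(u(t)+\frac14 t\,\dot u(t)\big)-\inf_{\mathcal H}f=o\big(1/t^3\big)$; - (iv) $f(u(t))-\inf_{\mathcal H}f=o\big(1/t^3\big)$; - (v) $u(t)$ converges weakly to some $u_\infty\in\operatorname{argmin}_{\mathcal H}f$.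 -/

import Mathlib

open Set Filter Topology Asymptotics

/-- The set of global minimizers of `f`. -/
def argmin {H : Type*} (f : H → ℝ) : Set H := {z | IsMinOn f univ z}

/-- `u : [t₀, +∞[ → H` is a classical global solution of
`u''' + ((α + 7) / t) u'' + (5 (α + 1) / t²) u' + ∇f (u + (t / 4) u') = 0`.
Only the values of `u` on `[t₀, +∞[` matter; derivatives at `t₀` are one-sided. -/
structure IsTogesVSolution {H : Type*} [NormedAddCommGroup H] [InnerProductSpace ℝ H]
    [CompleteSpace H] (α t₀ : ℝ) (f : H → ℝ) (u : ℝ → H) : Prop where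
  contDiffOn : ContDiffOn ℝ 3 u (Ici t₀)
  eqn : ∀ t ∈ Ici t₀,
    iteratedDerivWithin 3 u (Ici t₀) t
      + ((α + 7) / t) • iteratedDerivWithin 2 u (Ici t₀) t
      + (5 * (α + 1) / t ^ 2) • derivWithin u (Ici t₀) t
      + gradient f (u t + (t / 4) • derivWithin u (Ici t₀) t) = 0

/-- `u t` converges weakly to `x` as `t → +∞`. -/
def WeaklyConvergesTo {H : Type*} [NormedAddCommGroup H] [InnerProductSpace ℝ H]
    (u : ℝ → H) (x : H) : Prop :=
  Tendsto (fun t => toWeakSpace ℝ H (u t)) atTop (𝓝 (toWeakSpace ℝ H x))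

/-!
The extrapolated curve `v = u + (t / 4) u'` solves the second order system
`v'' + ((α + 1) / t) v' + (t / 4) ∇f(v) = 0`. For a minimizer `z`, convexity makes the anchored
energy `(t³ / 4) (f(v) - f(z)) + ‖α (v - z) + t v'‖² / 2` nonincreasing when `α ≥ 3`, whence the
`O(1 / t³)` bound. When `α > 3`, the mechanical energy `M = (t³ / 4) (f(v) - f(z)) + t² ‖v'‖² / 2`
plus a multiple of the anchored energy has derivative at most `-M / t`. As `1 / t` is not integrable
at infinity, `M → 0`, so that `f(v) - f(z) = o(1 / t³)` and `t v' → 0`; hence `‖v - z‖` converges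
for every minimizer `z`, and Opial's lemma gives the weak convergence of `v`. Finally
`(t⁴ u)' = 4 t³ v` exhibits `u` as a weighted average of `v`, which transfers weak limits, and with
the tangent inequality of `f` also the decay of the values, from `v` to `u`.
-/

section RealFunctions

variable {F F' y y' : ℝ → ℝ} {c K L : ℝ}

theorem exists_antitoneOn_Ici_of_hasDerivAt_nonpos
    (hF : ∀ᶠ t in atTop, HasDerivAt F (F' t) t) (hF' : ∀ᶠ t in atTop, F' t ≤ 0) :
    ∃ a, AntitoneOn F (Ici a) := by
  obtain ⟨a, ha⟩ := eventually_atTop.1 (hF.and hF')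
  refine ⟨a, antitoneOn_of_deriv_nonpos (convex_Ici a)
    (fun t ht => (ha t ht).1.continuousAt.continuousWithinAt) (fun t ht => ?_) (fun t ht => ?_)⟩
  · exact (ha t (interior_subset ht)).1.differentiableAt.differentiableWithinAt
  · rw [(ha t (interior_subset ht)).1.deriv]
    exact (ha t (interior_subset ht)).2

theorem exists_tendsto_of_hasDerivAt_nonpos (hF : ∀ᶠ t in atTop, HasDerivAt F (F' t) t)
    (hF' : ∀ᶠ t in atTop, F' t ≤ 0) (hK : ∀ᶠ t in atTop, K ≤ F t) :
    ∃ L, Tendsto F atTop (𝓝 L) := by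
  obtain ⟨a, ha⟩ := exists_antitoneOn_Ici_of_hasDerivAt_nonpos hF hF'
  have hmax : (fun t => F (max a t)) =ᶠ[atTop] F := by
    filter_upwards [eventually_ge_atTop a] with t ht
    rw [max_eq_right ht]
  have hanti : Antitone fun t => F (max a t) := fun s t hst =>
    ha (le_max_left a s) (le_max_left a t) (max_le_max_left a hst)
  rcases tendsto_atTop_of_antitone hanti with hbot | ⟨L, hL⟩
  · obtain ⟨t, hKt, htK⟩ :=
      (hK.and ((hbot.congr' hmax).eventually_lt_atBot K)).exists
    exact absurd hKt htK.not_ge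
  · exact ⟨L, hL.congr' hmax⟩

-- Otherwise `F + (L / 2) log t` would be eventually decreasing.
theorem limit_nonpos_of_hasDerivAt_le_neg_div (hF : ∀ᶠ t in atTop, HasDerivAt F (F' t) t)
    (hK : ∀ᶠ t in atTop, K ≤ F t) (hF' : ∀ᶠ t in atTop, F' t ≤ -(y t / t))
    (hy : Tendsto y atTop (𝓝 L)) : L ≤ 0 := by
  by_contra! hL
  have hderiv : ∀ᶠ t in atTop,
      HasDerivAt (fun s => F s + L / 2 * Real.log s) (F' t + L / 2 * t⁻¹) t := by
    filter_upwards [hF, eventually_gt_atTop 0] with t hFt ht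
    exact hFt.add ((Real.hasDerivAt_log ht.ne').const_mul _)
  have hderiv_nonpos : ∀ᶠ t in atTop, F' t + L / 2 * t⁻¹ ≤ 0 := by
    filter_upwards [hF', hy.eventually_const_lt (half_lt_self hL), eventually_gt_atTop 0]
      with t hFt hyt ht
    have := mul_le_mul_of_nonneg_right hyt.le (inv_nonneg.2 ht.le)
    rw [div_eq_mul_inv] at hFt
    linarith
  obtain ⟨a, ha⟩ := exists_antitoneOn_Ici_of_hasDerivAt_nonpos hderiv hderiv_nonpos
  have hlog : Tendsto (fun t => L / 2 * Real.log t) atTop atTop :=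
    Real.tendsto_log_atTop.const_mul_atTop (half_pos hL)
  obtain ⟨t, hKt, hlogt, hat⟩ := (hK.and ((hlog.eventually_gt_atTop
    (F a + L / 2 * Real.log a - K)).and (eventually_ge_atTop a))).exists
  have : F t + L / 2 * Real.log t ≤ F a + L / 2 * Real.log a := ha self_mem_Ici hat hat
  linarith

-- `(t ^ c * (y - K))' = c * t ^ (c - 1) * (y + (t / c) * y' - K)`.
theorem eventually_lt_of_add_mul_deriv_le (hc : 0 < c)
    (hy : ∀ᶠ t in atTop, HasDerivAt y (y' t) t) (hK : ∀ᶠ t in atTop, y t + t / c * y' t ≤ K)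
    (hKL : K < L) : ∀ᶠ t in atTop, y t < L := by
  have hderiv : ∀ᶠ t in atTop, HasDerivAt (fun s => s ^ c * (y s - K))
      (c * t ^ (c - 1) * (y t + t / c * y' t - K)) t := by
    filter_upwards [hy, eventually_gt_atTop 0] with t hyt ht
    refine ((Real.hasDerivAt_rpow_const (Or.inl ht.ne')).fun_mul (hyt.sub_const K)).congr_deriv ?_
    rw [Real.rpow_sub_one ht.ne']
    field_simp
    ring
  have hderiv_nonpos : ∀ᶠ t in atTop, c * t ^ (c - 1) * (y t + t / c * y' t - K) ≤ 0 := by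
    filter_upwards [hK, eventually_ge_atTop 0] with t hKt ht
    exact mul_nonpos_of_nonneg_of_nonpos (by positivity) (by linarith)
  obtain ⟨a, ha⟩ := exists_antitoneOn_Ici_of_hasDerivAt_nonpos hderiv hderiv_nonpos
  have hlim : Tendsto (fun t : ℝ => a ^ c * (y a - K) / t ^ c) atTop (𝓝 0) :=
    tendsto_const_nhds.div_atTop (tendsto_rpow_atTop hc)
  filter_upwards [hlim.eventually_lt_const (sub_pos.2 hKL), eventually_ge_atTop a,
    eventually_gt_atTop 0] with t htL hat ht
  have : y t - K ≤ a ^ c * (y a - K) / t ^ c := by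
    rw [le_div_iff₀' (by positivity)]
    exact ha self_mem_Ici hat hat
  linarith

theorem tendsto_of_tendsto_add_mul_deriv (hc : 0 < c)
    (hy : ∀ᶠ t in atTop, HasDerivAt y (y' t) t)
    (hL : Tendsto (fun t => y t + t / c * y' t) atTop (𝓝 L)) : Tendsto y atTop (𝓝 L) := by
  refine tendsto_order.2 ⟨fun l hl => ?_, fun r hr => ?_⟩
  · obtain ⟨m, hlm, hmL⟩ := exists_between hl
    have hneg : ∀ᶠ t in atTop, -y t + t / c * -y' t ≤ -m := by
      filter_upwards [hL.eventually_const_lt hmL] with t ht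
      linarith
    filter_upwards [eventually_lt_of_add_mul_deriv_le hc (hy.mono fun t ht => ht.fun_neg) hneg
      (neg_lt_neg hlm)] with t ht
    exact neg_lt_neg_iff.1 ht
  · obtain ⟨m, hLm, hmr⟩ := exists_between hr
    exact eventually_lt_of_add_mul_deriv_le hc hy (hL.eventually_le_const hLm) hmr

theorem isBigO_one_div_pow_iff {n : ℕ} (hy : ∀ t, 0 ≤ y t) :
    (y =O[atTop] fun t : ℝ => 1 / t ^ n) ↔ ∃ K, ∀ᶠ t in atTop, t ^ n * y t ≤ K := by
  refine isBigO_iff.trans (exists_congr fun K => eventually_congr ?_)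
  filter_upwards [eventually_gt_atTop 0] with t ht
  rw [Real.norm_of_nonneg (hy t), Real.norm_of_nonneg (by positivity), mul_one_div,
    le_div_iff₀' (by positivity)]

theorem isLittleO_one_div_pow_iff {n : ℕ} :
    (y =o[atTop] fun t : ℝ => 1 / t ^ n) ↔ Tendsto (fun t => t ^ n * y t) atTop (𝓝 0) := by
  have hne : ∀ᶠ t : ℝ in atTop, 1 / t ^ n = 0 → y t = 0 := by
    filter_upwards [eventually_gt_atTop 0] with t ht h
    exact absurd h (by positivity)
  rw [isLittleO_iff_tendsto' hne]
  simp only [div_div_eq_mul_div, div_one, mul_comm]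

end RealFunctions

section WeakTopology

variable {ι E : Type*} [NormedAddCommGroup E] [NormedSpace ℝ E] {l : Filter ι} {v : ι → E} {x : E}

theorem tendsto_toWeakSpace_iff :
    Tendsto (fun i => toWeakSpace ℝ E (v i)) l (𝓝 (toWeakSpace ℝ E x)) ↔
      ∀ φ : StrongDual ℝ E, Tendsto (fun i => φ (v i)) l (𝓝 (φ x)) :=
  WeakBilin.tendsto_iff_forall_eval_tendsto _ (separatingDual_iff_injective.1 inferInstance)

theorem apply_eq_of_mapClusterPt {r : ℝ} (φ : StrongDual ℝ E)
    (hx : MapClusterPt (toWeakSpace ℝ E x) l fun i => toWeakSpace ℝ E (v i))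
    (hφ : Tendsto (fun i => φ (v i)) l (𝓝 r)) : φ x = r := by
  have hcont : Continuous fun w : WeakSpace ℝ E => φ ((toWeakSpace ℝ E).symm w) :=
    WeakBilin.eval_continuous (topDualPairing ℝ E).flip φ
  have hcluster : MapClusterPt (φ x) l fun i => φ (v i) :=
    (hx.continuousAt_comp hcont.continuousAt :)
  exact eq_of_nhds_neBot (hcluster.neBot.mono (inf_le_inf_left _ hφ))

theorem le_of_mapClusterPt_toWeakSpace {f : E → ℝ} {m : ℝ} (hf : ConvexOn ℝ univ f)
    (hc : LowerSemicontinuous f)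
    (hx : MapClusterPt (toWeakSpace ℝ E x) l fun i => toWeakSpace ℝ E (v i))
    (hm : Tendsto (fun i => f (v i)) l (𝓝 m)) : f x ≤ m := by
  refine le_of_forall_gt_imp_ge_of_dense fun r hr => ?_
  have hconvex : Convex ℝ {y | f y ≤ r} := by simpa only [mem_univ, true_and] using hf.convex_le r
  have hclosed : IsClosed {y | f y ≤ r} := hc.isClosed_preimage r
  have hweak : IsClosed (toWeakSpace ℝ E '' {y | f y ≤ r}) := by
    rw [← hclosed.closure_eq, hconvex.toWeakSpace_closure ℝ]
    exact isClosed_closure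
  have hmem : ∀ᶠ i in l, toWeakSpace ℝ E (v i) ∈ toWeakSpace ℝ E '' {y | f y ≤ r} := by
    filter_upwards [hm.eventually_le_const hr] with i hi
    exact mem_image_of_mem _ hi
  exact (toWeakSpace ℝ E).injective.mem_set_image.1 (hweak.mem_of_mapClusterPt hx hmem)

end WeakTopology

section Hilbert

variable {ι H : Type*} [NormedAddCommGroup H] [InnerProductSpace ℝ H] {l : Filter ι}
  {v : ι → H} {x y : H}

theorem eq_of_mapClusterPt_of_tendsto_norm_sub {a b : ℝ}
    (hx : MapClusterPt (toWeakSpace ℝ H x) l fun i => toWeakSpace ℝ H (v i))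
    (hy : MapClusterPt (toWeakSpace ℝ H y) l fun i => toWeakSpace ℝ H (v i))
    (ha : Tendsto (fun i => ‖v i - x‖) l (𝓝 a)) (hb : Tendsto (fun i => ‖v i - y‖) l (𝓝 b)) :
    x = y := by
  have hinner : Tendsto (fun i => innerSL ℝ (x - y) (v i)) l
      (𝓝 ((b ^ 2 - a ^ 2 + (‖x‖ ^ 2 - ‖y‖ ^ 2)) / 2)) := by
    refine ((((hb.pow 2).sub (ha.pow 2)).add_const (‖x‖ ^ 2 - ‖y‖ ^ 2)).div_const 2).congr
      fun i => ?_
    rw [innerSL_apply_apply, real_inner_comm, inner_sub_right, norm_sub_sq_real, norm_sub_sq_real]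
    ring
  have hxy : innerSL ℝ (x - y) x = innerSL ℝ (x - y) y :=
    (apply_eq_of_mapClusterPt _ hx hinner).trans (apply_eq_of_mapClusterPt _ hy hinner).symm
  rw [← sub_eq_zero, ← map_sub, innerSL_apply_apply, inner_self_eq_zero] at hxy
  exact sub_eq_zero.1 hxy

variable [CompleteSpace H]

theorem inclusionInDoubleDualWeak_surjective :
    Function.Surjective (NormedSpace.inclusionInDoubleDualWeak ℝ H) := by
  intro Φ
  let ψ : StrongDual ℝ H := (WeakDual.toStrongDual Φ).comp
    (InnerProductSpace.toDual ℝ H).toContinuousLinearEquiv.toContinuousLinearMap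
  refine ⟨toWeakSpace ℝ H ((InnerProductSpace.toDual ℝ H).symm ψ), ?_⟩
  refine DFunLike.ext _ _ fun φ => ?_
  rw [← (InnerProductSpace.toDual ℝ H).apply_symm_apply φ]
  change inner ℝ ((InnerProductSpace.toDual ℝ H).symm φ) ((InnerProductSpace.toDual ℝ H).symm ψ) = _
  rw [real_inner_comm, InnerProductSpace.toDual_symm_apply]
  rfl

theorem isCompact_closure_toWeakSpace_image {S : Set H} (hS : Bornology.IsBounded S) :
    IsCompact (closure (toWeakSpace ℝ H '' S)) := by
  refine NormedSpace.isCompact_closure_of_isBounded ℝ H _ ?_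
    (by rw [inclusionInDoubleDualWeak_surjective.range_eq]; exact subset_univ _)
  rwa [preimage_image_eq _ (toWeakSpace ℝ H).injective]

theorem exists_tendsto_toWeakSpace_of_opial [l.NeBot] {S : Set H} (hS : S.Nonempty)
    (hnorm : ∀ z ∈ S, ∃ r, Tendsto (fun i => ‖v i - z‖) l (𝓝 r))
    (hcluster : ∀ x, MapClusterPt (toWeakSpace ℝ H x) l (fun i => toWeakSpace ℝ H (v i)) → x ∈ S) :
    ∃ x ∈ S, Tendsto (fun i => toWeakSpace ℝ H (v i)) l (𝓝 (toWeakSpace ℝ H x)) := by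
  obtain ⟨z, hz⟩ := hS
  obtain ⟨r, hr⟩ := hnorm z hz
  have hK : IsCompact (closure (toWeakSpace ℝ H '' Metric.closedBall z (r + 1))) :=
    isCompact_closure_toWeakSpace_image Metric.isBounded_closedBall
  have hvK : ∀ᶠ i in l, toWeakSpace ℝ H (v i) ∈
      closure (toWeakSpace ℝ H '' Metric.closedBall z (r + 1)) := by
    filter_upwards [hr.eventually_le_const (lt_add_one r)] with i hi
    exact subset_closure (mem_image_of_mem _ (mem_closedBall_iff_norm.2 hi))
  obtain ⟨w, -, hw⟩ := hK.exists_mapClusterPt (le_principal_iff.2 hvK)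
  obtain ⟨x, rfl⟩ := (toWeakSpace ℝ H).surjective w
  refine ⟨x, hcluster x hw, hK.tendsto_nhds_of_unique_mapClusterPt hvK fun w' _ hw' => ?_⟩
  obtain ⟨y, rfl⟩ := (toWeakSpace ℝ H).surjective w'
  obtain ⟨a, ha⟩ := hnorm y (hcluster y hw')
  obtain ⟨b, hb⟩ := hnorm x (hcluster x hw)
  rw [eq_of_mapClusterPt_of_tendsto_norm_sub hw' hw ha hb]

end Hilbert

section Convexity

variable {E : Type*} [NormedAddCommGroup E] [NormedSpace ℝ E] {s : Set E} {f : E → ℝ}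

theorem tangent_le_of_convexOn {f' : E →L[ℝ] ℝ} {x y : E} (hf : ConvexOn ℝ s f)
    (hx : x ∈ s) (hy : y ∈ s) (hf' : HasFDerivAt f f' x) : f x + f' (y - x) ≤ f y := by
  have hline : HasDerivAt (f ∘ AffineMap.lineMap x y) (f' (y - x)) (0 : ℝ) :=
    HasFDerivAt.comp_hasDerivAt 0 (by rwa [AffineMap.lineMap_apply_zero])
      AffineMap.hasDerivAt_lineMap
  have hslope := (hf.comp_affineMap (AffineMap.lineMap x y)).le_slope_of_hasDerivAt
    (x := 0) (y := 1) (by simpa) (by simpa) one_pos hline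
  simp only [slope_def_field, Function.comp_apply, AffineMap.lineMap_apply_zero,
    AffineMap.lineMap_apply_one, sub_zero, div_one] at hslope
  linarith

end Convexity

section Energy

variable {H : Type*} {v v' : ℝ → H} {α c t : ℝ} {p : ℕ} {f : H → ℝ} {z : H}

/-- The potential energy `c t ^ p (f (v t) - f z)` of an `IsInertialTrajectory`, counted from the
point `z` and multiplied by `t ^ 2`. -/
noncomputable def potentialEnergy (c : ℝ) (p : ℕ) (f : H → ℝ) (z : H) (v : ℝ → H) (t : ℝ) : ℝ :=
  c * t ^ (p + 2) * (f (v t) - f z)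

theorem potentialEnergy_nonneg (hc : 0 ≤ c) (hz : z ∈ argmin f) (ht : 0 ≤ t) :
    0 ≤ potentialEnergy c p f z v t :=
  mul_nonneg (by positivity) (sub_nonneg.2 (hz (mem_univ (v t))))

variable [NormedAddCommGroup H]

/-- The potential plus kinetic energy of `v`, both multiplied by `t ^ 2`; the velocity `v'` of `v`
is a separate argument. -/
noncomputable def mechanicalEnergy (c : ℝ) (p : ℕ) (f : H → ℝ) (z : H) (v v' : ℝ → H) (t : ℝ) :
    ℝ :=
  potentialEnergy c p f z v t + t ^ 2 / 2 * ‖v' t‖ ^ 2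

theorem mechanicalEnergy_nonneg (hc : 0 ≤ c) (hz : z ∈ argmin f) (ht : 0 ≤ t) :
    0 ≤ mechanicalEnergy c p f z v v' t :=
  add_nonneg (potentialEnergy_nonneg hc hz ht) (by positivity)

/-- The Lyapunov function of the inertial dynamics with anchor `z`, in which the momentum
`α • (v - z) + t • v'` replaces the velocity. -/
noncomputable def anchoredEnergy [NormedSpace ℝ H] (α c : ℝ) (p : ℕ) (f : H → ℝ) (z : H)
    (v v' : ℝ → H) (t : ℝ) : ℝ :=
  potentialEnergy c p f z v t + 1 / 2 * ‖α • (v t - z) + t • v' t‖ ^ 2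

theorem anchoredEnergy_nonneg [NormedSpace ℝ H] (hc : 0 ≤ c) (hz : z ∈ argmin f) (ht : 0 ≤ t) :
    0 ≤ anchoredEnergy α c p f z v v' t :=
  add_nonneg (potentialEnergy_nonneg hc hz ht) (by positivity)

theorem hasDerivAt_potentialEnergy [InnerProductSpace ℝ H] [CompleteSpace H]
    (hf : DifferentiableAt ℝ f (v t)) (hv : HasDerivAt v (v' t) t) :
    HasDerivAt (potentialEnergy c p f z v)
      (c * t ^ (p + 1) * ((p + 2) * (f (v t) - f z) + t * inner ℝ (gradient f (v t)) (v' t)))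
      t := by
  have hpow : HasDerivAt (fun s : ℝ => c * s ^ (p + 2)) (c * ((p + 2) * t ^ (p + 1))) t := by
    simpa using (hasDerivAt_pow (p + 2) t).const_mul c
  refine (hpow.mul ((hf.hasFDerivAt.comp_hasDerivAt t hv).sub_const (f z))).congr_deriv ?_
  rw [inner_gradient_left, Function.comp_apply]
  ring

end Energy

section InertialTrajectory

variable {H : Type*} [NormedAddCommGroup H] [InnerProductSpace ℝ H] [CompleteSpace H]

/-- For large `t`, the trajectory `v` with velocity `v'` solves the inertial gradient system
`v'' + ((α + 1) / t) v' + c t ^ p ∇f(v) = 0` with vanishing damping and time scaling `c t ^ p`. -/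
structure IsInertialTrajectory (α c : ℝ) (p : ℕ) (f : H → ℝ) (v v' : ℝ → H) : Prop where
  hasDerivAt : ∀ᶠ t in atTop, HasDerivAt v (v' t) t
  hasDerivAt_velocity : ∀ᶠ t in atTop,
    HasDerivAt v' (-(((α + 1) / t) • v' t) - (c * t ^ p) • gradient f (v t)) t

namespace IsInertialTrajectory

variable {α c : ℝ} {p : ℕ} {f : H → ℝ} {v v' : ℝ → H} {z : H}

theorem hasDerivAt_mechanicalEnergy (hv : IsInertialTrajectory α c p f v v')
    (hd : Differentiable ℝ f) (z : H) :
    ∀ᶠ t in atTop, HasDerivAt (mechanicalEnergy c p f z v v')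
      ((p + 2) * (potentialEnergy c p f z v t / t) - α * t * ‖v' t‖ ^ 2) t := by
  filter_upwards [hv.hasDerivAt, hv.hasDerivAt_velocity, eventually_ne_atTop 0] with t hvt hvt' ht
  refine ((hasDerivAt_potentialEnergy (hd (v t)) hvt).add
    (((hasDerivAt_pow 2 t).div_const 2).mul hvt'.norm_sq)).congr_deriv ?_
  simp only [inner_sub_right, inner_neg_right, real_inner_smul_right, real_inner_self_eq_norm_sq,
    real_inner_comm (gradient f (v t)), potentialEnergy]
  field_simp
  ring

theorem hasDerivAt_anchoredEnergy (hv : IsInertialTrajectory α c p f v v')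
    (hd : Differentiable ℝ f) (z : H) :
    ∀ᶠ t in atTop, HasDerivAt (anchoredEnergy α c p f z v v')
      (c * t ^ (p + 1) * ((p + 2) * (f (v t) - f z) - α * inner ℝ (gradient f (v t)) (v t - z)))
      t := by
  filter_upwards [hv.hasDerivAt, hv.hasDerivAt_velocity, eventually_ne_atTop 0] with t hvt hvt' ht
  have hmomentum : HasDerivAt (fun s => α • (v s - z) + s • v' s)
      (-((c * t ^ (p + 1)) • gradient f (v t))) t := by
    refine (((hvt.sub_const z).const_smul α).add ((hasDerivAt_id t).smul hvt')).congr_deriv ?_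
    simp only [id]
    match_scalars <;> field_simp <;> ring
  refine ((hasDerivAt_potentialEnergy (hd (v t)) hvt).add
    (hmomentum.norm_sq.const_mul (1 / 2))).congr_deriv ?_
  simp only [inner_neg_right, inner_add_left, real_inner_smul_right,
    real_inner_comm (gradient f (v t))]
  ring

theorem exists_hasDerivAt_anchoredEnergy_le (hv : IsInertialTrajectory α c p f v v')
    (hconv : ConvexOn ℝ univ f) (hd : Differentiable ℝ f) (hc : 0 ≤ c) (hα : 0 ≤ α) (z : H) :
    ∃ A' : ℝ → ℝ, (∀ᶠ t in atTop, HasDerivAt (anchoredEnergy α c p f z v v') (A' t) t) ∧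
      ∀ᶠ t in atTop, A' t ≤ -((α - (p + 2)) * (potentialEnergy c p f z v t / t)) := by
  refine ⟨_, hv.hasDerivAt_anchoredEnergy hd z, ?_⟩
  filter_upwards [eventually_gt_atTop 0] with t ht
  have htangent : f (v t) - f z ≤ inner ℝ (gradient f (v t)) (v t - z) := by
    have := tangent_le_of_convexOn hconv (mem_univ (v t)) (mem_univ z) (hd (v t)).hasFDerivAt
    rw [← inner_gradient_left, ← neg_sub, inner_neg_right] at this
    linarith
  calc c * t ^ (p + 1) * ((p + 2) * (f (v t) - f z) - α * inner ℝ (gradient f (v t)) (v t - z))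
      ≤ c * t ^ (p + 1) * ((p + 2) * (f (v t) - f z) - α * (f (v t) - f z)) := by gcongr
    _ = -((α - (p + 2)) * (potentialEnergy c p f z v t / t)) := by
      unfold potentialEnergy
      field_simp
      ring

theorem exists_tendsto_anchoredEnergy (hv : IsInertialTrajectory α c p f v v')
    (hconv : ConvexOn ℝ univ f) (hd : Differentiable ℝ f) (hc : 0 ≤ c) (hα : p + 2 ≤ α)
    (hz : z ∈ argmin f) : ∃ L, Tendsto (anchoredEnergy α c p f z v v') atTop (𝓝 L) := by
  obtain ⟨A', hA, hA'⟩ := hv.exists_hasDerivAt_anchoredEnergy_le hconv hd hc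
    (le_trans (by positivity) hα) z
  refine exists_tendsto_of_hasDerivAt_nonpos (K := 0) hA ?_ ?_
  · filter_upwards [hA', eventually_ge_atTop 0] with t hAt ht
    exact hAt.trans (neg_nonpos.2 (mul_nonneg (sub_nonneg.2 hα)
      (div_nonneg (potentialEnergy_nonneg hc hz ht) ht)))
  · filter_upwards [eventually_ge_atTop 0] with t ht using anchoredEnergy_nonneg hc hz ht

-- The decay of the anchored energy absorbs the growth of the potential part of the mechanical one.
theorem exists_hasDerivAt_mechanicalEnergy_add_le (hv : IsInertialTrajectory α c p f v v')
    (hconv : ConvexOn ℝ univ f) (hd : Differentiable ℝ f) (hc : 0 ≤ c) (hα : p + 2 < α) (z : H) :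
    ∃ k ≥ 0, ∃ F' : ℝ → ℝ,
      (∀ᶠ t in atTop, HasDerivAt (fun s => mechanicalEnergy c p f z v v' s +
        k * anchoredEnergy α c p f z v v' s) (F' t) t) ∧
      ∀ᶠ t in atTop, F' t ≤ -(mechanicalEnergy c p f z v v' t / t) := by
  have hα_half : 1 / 2 ≤ α := by linarith [p.cast_nonneg (α := ℝ)]
  have hgap : 0 < α - (p + 2) := sub_pos.2 hα
  obtain ⟨A', hA, hA'⟩ := hv.exists_hasDerivAt_anchoredEnergy_le hconv hd hc
    (one_half_pos.le.trans hα_half) z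
  have hk : 0 ≤ (p + 3) / (α - (p + 2)) := by positivity
  refine ⟨(p + 3) / (α - (p + 2)), hk, fun t =>
    (p + 2) * (potentialEnergy c p f z v t / t) - α * t * ‖v' t‖ ^ 2 +
      (p + 3) / (α - (p + 2)) * A' t, ?_, ?_⟩
  · filter_upwards [hv.hasDerivAt_mechanicalEnergy hd z, hA] with t hMt hAt
    exact hMt.add (hAt.const_mul _)
  · filter_upwards [hA', eventually_gt_atTop 0] with t hAt ht
    have hkinetic : 1 / 2 * (t * ‖v' t‖ ^ 2) ≤ α * (t * ‖v' t‖ ^ 2) := by gcongr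
    have hpotential : (p + 3) / (α - (p + 2)) * A' t
        ≤ -((p + 3) * (potentialEnergy c p f z v t / t)) := by
      refine (mul_le_mul_of_nonneg_left hAt hk).trans_eq ?_
      field_simp
    have hM : mechanicalEnergy c p f z v v' t / t
        = potentialEnergy c p f z v t / t + 1 / 2 * (t * ‖v' t‖ ^ 2) := by
      unfold mechanicalEnergy
      field_simp
    rw [hM]
    linarith

theorem tendsto_mechanicalEnergy (hv : IsInertialTrajectory α c p f v v')
    (hconv : ConvexOn ℝ univ f) (hd : Differentiable ℝ f) (hc : 0 ≤ c) (hα : p + 2 < α)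
    (hz : z ∈ argmin f) : Tendsto (mechanicalEnergy c p f z v v') atTop (𝓝 0) := by
  obtain ⟨k, hk, F', hF, hF'⟩ := hv.exists_hasDerivAt_mechanicalEnergy_add_le hconv hd hc hα z
  have hM : ∀ᶠ t in atTop, 0 ≤ mechanicalEnergy c p f z v v' t := by
    filter_upwards [eventually_ge_atTop 0] with t ht using mechanicalEnergy_nonneg hc hz ht
  have hF_nonneg : ∀ᶠ t in atTop, 0 ≤ mechanicalEnergy c p f z v v' t +
      k * anchoredEnergy α c p f z v v' t := by
    filter_upwards [hM, eventually_ge_atTop 0] with t hMt ht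
    exact add_nonneg hMt (mul_nonneg hk (anchoredEnergy_nonneg hc hz ht))
  have hF'_nonpos : ∀ᶠ t in atTop, F' t ≤ 0 := by
    filter_upwards [hF', hM, eventually_ge_atTop 0] with t hFt hMt ht
    exact hFt.trans (neg_nonpos.2 (div_nonneg hMt ht))
  obtain ⟨L, hL⟩ := exists_tendsto_of_hasDerivAt_nonpos hF hF'_nonpos hF_nonneg
  obtain ⟨N, hN⟩ := hv.exists_tendsto_anchoredEnergy hconv hd hc hα.le hz
  have hlim : Tendsto (mechanicalEnergy c p f z v v') atTop (𝓝 (L - k * N)) := by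
    simpa only [add_sub_cancel_right] using hL.sub (hN.const_mul k)
  have hzero : L - k * N = 0 :=
    (limit_nonpos_of_hasDerivAt_le_neg_div hF hF_nonneg hF' hlim).antisymm
      (ge_of_tendsto hlim hM)
  rwa [hzero] at hlim

theorem isBigO_value (hv : IsInertialTrajectory α c p f v v') (hconv : ConvexOn ℝ univ f)
    (hd : Differentiable ℝ f) (hc : 0 < c) (hα : p + 2 ≤ α) (hz : z ∈ argmin f) :
    (fun t => f (v t) - f z) =O[atTop] fun t : ℝ => 1 / t ^ (p + 2) := by
  obtain ⟨L, hL⟩ := hv.exists_tendsto_anchoredEnergy hconv hd hc.le hα hz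
  refine (isBigO_one_div_pow_iff fun t => sub_nonneg.2 (hz (mem_univ (v t)))).2
    ⟨(L + 1) / c, ?_⟩
  filter_upwards [hL.eventually_le_const (lt_add_one L)] with t ht
  rw [le_div_iff₀' hc, ← mul_assoc]
  exact (le_add_of_nonneg_right (by positivity)).trans ht

theorem tendsto_potentialEnergy (hv : IsInertialTrajectory α c p f v v')
    (hconv : ConvexOn ℝ univ f) (hd : Differentiable ℝ f) (hc : 0 ≤ c) (hα : p + 2 < α)
    (hz : z ∈ argmin f) : Tendsto (potentialEnergy c p f z v) atTop (𝓝 0) := by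
  refine squeeze_zero' ?_ (Eventually.of_forall fun t => ?_)
    (hv.tendsto_mechanicalEnergy hconv hd hc hα hz)
  · filter_upwards [eventually_ge_atTop 0] with t ht using potentialEnergy_nonneg hc hz ht
  · exact le_add_of_nonneg_right (by positivity)

theorem isLittleO_value (hv : IsInertialTrajectory α c p f v v') (hconv : ConvexOn ℝ univ f)
    (hd : Differentiable ℝ f) (hc : 0 < c) (hα : p + 2 < α) (hz : z ∈ argmin f) :
    (fun t => f (v t) - f z) =o[atTop] fun t : ℝ => 1 / t ^ (p + 2) := by
  rw [isLittleO_one_div_pow_iff, ← mul_zero c⁻¹]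
  refine ((hv.tendsto_potentialEnergy hconv hd hc.le hα hz).const_mul c⁻¹).congr fun t => ?_
  rw [potentialEnergy, mul_assoc, inv_mul_cancel_left₀ hc.ne']

theorem tendsto_smul_velocity (hv : IsInertialTrajectory α c p f v v')
    (hconv : ConvexOn ℝ univ f) (hd : Differentiable ℝ f) (hc : 0 ≤ c) (hα : p + 2 < α)
    (hz : z ∈ argmin f) : Tendsto (fun t => t • v' t) atTop (𝓝 0) := by
  have hsq : Tendsto (fun t => t ^ 2 / 2 * ‖v' t‖ ^ 2) atTop (𝓝 0) := by
    refine squeeze_zero' (Eventually.of_forall fun t => by positivity) ?_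
      (hv.tendsto_mechanicalEnergy hconv hd hc hα hz)
    filter_upwards [eventually_ge_atTop 0] with t ht
    exact le_add_of_nonneg_left (potentialEnergy_nonneg hc hz ht)
  have hsqrt := (hsq.const_mul 2).sqrt
  rw [mul_zero, Real.sqrt_zero] at hsqrt
  refine tendsto_zero_iff_norm_tendsto_zero.2 (hsqrt.congr fun t => ?_)
  rw [← mul_assoc, mul_div_cancel₀ _ two_ne_zero, ← sq_abs t, ← Real.norm_eq_abs, ← mul_pow,
    ← norm_smul, Real.sqrt_sq (norm_nonneg _)]

theorem exists_tendsto_norm_sub (hv : IsInertialTrajectory α c p f v v')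
    (hconv : ConvexOn ℝ univ f) (hd : Differentiable ℝ f) (hc : 0 ≤ c) (hα : p + 2 < α)
    (hz : z ∈ argmin f) : ∃ r, Tendsto (fun t => ‖v t - z‖) atTop (𝓝 r) := by
  have hα0 : 0 < α := lt_of_le_of_lt (by positivity) hα
  obtain ⟨L, hL⟩ := hv.exists_tendsto_anchoredEnergy hconv hd hc hα.le hz
  have hmomentum : Tendsto (fun t => ‖α • (v t - z) + t • v' t‖) atTop (𝓝 √(2 * (L - 0))) := by
    refine ((hL.sub (hv.tendsto_potentialEnergy hconv hd hc hα hz)).const_mul 2).sqrt.congr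
      fun t => ?_
    rw [anchoredEnergy, add_sub_cancel_left, ← mul_assoc, mul_one_div_cancel two_ne_zero, one_mul,
      Real.sqrt_sq (norm_nonneg _)]
  have hgap : Tendsto (fun t => ‖α • (v t - z)‖ - ‖α • (v t - z) + t • v' t‖) atTop (𝓝 0) := by
    refine squeeze_zero_norm (fun t => ?_)
      (tendsto_zero_iff_norm_tendsto_zero.1 (hv.tendsto_smul_velocity hconv hd hc hα hz))
    rw [Real.norm_eq_abs, abs_sub_comm]
    exact (abs_norm_sub_norm_le _ _).trans_eq (by rw [add_sub_cancel_left])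
  refine ⟨α⁻¹ * (0 + √(2 * (L - 0))), ((hgap.add hmomentum).const_mul α⁻¹).congr fun t => ?_⟩
  rw [sub_add_cancel, norm_smul, Real.norm_of_nonneg hα0.le, inv_mul_cancel_left₀ hα0.ne']

theorem exists_weaklyConvergesTo (hv : IsInertialTrajectory α c p f v v')
    (hconv : ConvexOn ℝ univ f) (hd : Differentiable ℝ f) (hc : 0 < c) (hα : p + 2 < α)
    (hmin : (argmin f).Nonempty) : ∃ x ∈ argmin f, WeaklyConvergesTo v x := by
  refine exists_tendsto_toWeakSpace_of_opial hmin
    (fun z hz => hv.exists_tendsto_norm_sub hconv hd hc.le hα hz) fun x hx => ?_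
  obtain ⟨z, hz⟩ := hmin
  have hvalue : Tendsto (fun t => f (v t)) atTop (𝓝 (f z)) :=
    tendsto_sub_nhds_zero_iff.1 <| (hv.isBigO_value hconv hd hc hα.le hz).trans_tendsto <|
      tendsto_const_nhds.div_atTop (tendsto_pow_atTop (by positivity))
  have hxz : f x ≤ f z :=
    le_of_mapClusterPt_toWeakSpace hconv hd.continuous.lowerSemicontinuous hx hvalue
  exact fun y hy => hxz.trans (hz hy)

end IsInertialTrajectory

end InertialTrajectory

section Extrapolation

variable {E : Type*} [NormedAddCommGroup E] [NormedSpace ℝ E] {u u' : ℝ → E} {f : E → ℝ}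
  {c m K L : ℝ} {n : ℕ}

-- For `y = t ^ n * (f (u t) - m)`, the tangent inequality for `f` at `u t` reads
-- `y + t / (c - n) * y' ≤ c / (c - n) * (t ^ n * (f (u t + (t / c) • u' t) - m))`.
theorem eventually_pow_mul_sub_lt_of_extrapolation (hu : ∀ᶠ t in atTop, HasDerivAt u (u' t) t)
    (hf : ConvexOn ℝ univ f) (hd : Differentiable ℝ f) (hn : n < c)
    (hK : ∀ᶠ t in atTop, t ^ n * (f (u t + (t / c) • u' t) - m) ≤ K)
    (hKL : c / (c - n) * K < L) : ∀ᶠ t in atTop, t ^ n * (f (u t) - m) < L := by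
  have hc : 0 < c := n.cast_nonneg.trans_lt hn
  have hcn : 0 < c - n := sub_pos.2 hn
  have hderiv : ∀ᶠ t in atTop, HasDerivAt (fun s => s ^ n * (f (u s) - m))
      (n * t ^ (n - 1) * (f (u t) - m) + t ^ n * fderiv ℝ f (u t) (u' t)) t := by
    filter_upwards [hu] with t hut
    exact (hasDerivAt_pow n t).fun_mul
      (((hd (u t)).hasFDerivAt.comp_hasDerivAt t hut).sub_const m)
  refine eventually_lt_of_add_mul_deriv_le hcn hderiv ?_ hKL
  filter_upwards [hK, eventually_gt_atTop 0] with t hKt ht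
  have htangent : f (u t) + t / c * fderiv ℝ f (u t) (u' t) ≤ f (u t + (t / c) • u' t) := by
    have := tangent_le_of_convexOn hf (mem_univ (u t)) (mem_univ (u t + (t / c) • u' t))
      (hd (u t)).hasFDerivAt
    rwa [add_sub_cancel_left, map_smul, smul_eq_mul] at this
  have hpow : t * (n * t ^ (n - 1)) = n * t ^ n := by
    cases n with
    | zero => simp
    | succ k => rw [Nat.add_sub_cancel, pow_succ]; ring
  calc t ^ n * (f (u t) - m) + t / (c - n) *
        (n * t ^ (n - 1) * (f (u t) - m) + t ^ n * fderiv ℝ f (u t) (u' t))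
      = c / (c - n) * (t ^ n * (f (u t) + t / c * fderiv ℝ f (u t) (u' t) - m)) := by
        field_simp
        linear_combination (f (u t) - m) * hpow
    _ ≤ c / (c - n) * (t ^ n * (f (u t + (t / c) • u' t) - m)) := by gcongr
    _ ≤ c / (c - n) * K := by gcongr

theorem isBigO_sub_of_extrapolation (hu : ∀ᶠ t in atTop, HasDerivAt u (u' t) t)
    (hf : ConvexOn ℝ univ f) (hd : Differentiable ℝ f) (hm : ∀ x, m ≤ f x) (hn : n < c)
    (h : (fun t => f (u t + (t / c) • u' t) - m) =O[atTop] fun t : ℝ => 1 / t ^ n) :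
    (fun t => f (u t) - m) =O[atTop] fun t : ℝ => 1 / t ^ n := by
  obtain ⟨K, hK⟩ := (isBigO_one_div_pow_iff fun t => sub_nonneg.2 (hm _)).1 h
  refine (isBigO_one_div_pow_iff fun t => sub_nonneg.2 (hm _)).2 ⟨c / (c - n) * K + 1, ?_⟩
  exact (eventually_pow_mul_sub_lt_of_extrapolation hu hf hd hn hK (lt_add_one _)).mono
    fun t => le_of_lt

theorem isLittleO_sub_of_extrapolation (hu : ∀ᶠ t in atTop, HasDerivAt u (u' t) t)
    (hf : ConvexOn ℝ univ f) (hd : Differentiable ℝ f) (hm : ∀ x, m ≤ f x) (hn : n < c)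
    (h : (fun t => f (u t + (t / c) • u' t) - m) =o[atTop] fun t : ℝ => 1 / t ^ n) :
    (fun t => f (u t) - m) =o[atTop] fun t : ℝ => 1 / t ^ n := by
  rw [isLittleO_one_div_pow_iff] at h ⊢
  refine tendsto_order.2 ⟨fun l hl => ?_, fun r hr => ?_⟩
  · filter_upwards [eventually_ge_atTop 0] with t ht
    exact hl.trans_le (mul_nonneg (by positivity) (sub_nonneg.2 (hm _)))
  · have hc : 0 < c := n.cast_nonneg.trans_lt hn
    have hcn : 0 < c - n := sub_pos.2 hn
    obtain ⟨K, hK, hKr⟩ := exists_between (show 0 < (c - n) / c * r by positivity)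
    refine eventually_pow_mul_sub_lt_of_extrapolation hu hf hd hn (h.eventually_le_const hK) ?_
    calc c / (c - n) * K < c / (c - n) * ((c - n) / c * r) := by gcongr
      _ = r := by field_simp

theorem tendsto_toWeakSpace_of_extrapolation {x : E} (hu : ∀ᶠ t in atTop, HasDerivAt u (u' t) t)
    (hc : 0 < c)
    (h : Tendsto (fun t => toWeakSpace ℝ E (u t + (t / c) • u' t)) atTop (𝓝 (toWeakSpace ℝ E x))) :
    Tendsto (fun t => toWeakSpace ℝ E (u t)) atTop (𝓝 (toWeakSpace ℝ E x)) := by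
  rw [tendsto_toWeakSpace_iff] at h ⊢
  intro φ
  refine tendsto_of_tendsto_add_mul_deriv (y' := fun t => φ (u' t)) hc
    (hu.mono fun t ht => φ.hasFDerivAt.comp_hasDerivAt t ht) ((h φ).congr fun t => ?_)
  rw [map_add, map_smul, smul_eq_mul]

end Extrapolation

section Reduction

theorem hasDerivAt_iteratedDerivWithin {𝕜 E : Type*} [NontriviallyNormedField 𝕜]
    [NormedAddCommGroup E] [NormedSpace 𝕜 E] {s : Set 𝕜} {t : 𝕜} {n k : ℕ} {u : 𝕜 → E}
    (hu : ContDiffOn 𝕜 n u s) (hs : UniqueDiffOn 𝕜 s) (hk : k < n) (ht : s ∈ 𝓝 t) :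
    HasDerivAt (iteratedDerivWithin k u s) (iteratedDerivWithin (k + 1) u s t) t := by
  rw [iteratedDerivWithin_succ]
  exact (hu.differentiableOn_iteratedDerivWithin (mod_cast hk) hs t
    (mem_of_mem_nhds ht)).hasDerivWithinAt.hasDerivAt ht

namespace IsTogesVSolution

variable {H : Type*} [NormedAddCommGroup H] [InnerProductSpace ℝ H] [CompleteSpace H]
  {α t₀ t : ℝ} {f : H → ℝ} {u : ℝ → H}

theorem hasDerivAt_iteratedDerivWithin_Ici {k : ℕ} (hu : IsTogesVSolution α t₀ f u) (hk : k < 3)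
    (ht : t₀ < t) : HasDerivAt (iteratedDerivWithin k u (Ici t₀))
      (iteratedDerivWithin (k + 1) u (Ici t₀) t) t :=
  hasDerivAt_iteratedDerivWithin hu.contDiffOn (uniqueDiffOn_Ici t₀) hk (Ici_mem_nhds ht)

theorem hasDerivAt (hu : IsTogesVSolution α t₀ f u) (ht : t₀ < t) :
    HasDerivAt u (derivWithin u (Ici t₀) t) t := by
  simpa only [iteratedDerivWithin_zero, zero_add, iteratedDerivWithin_one] using
    hu.hasDerivAt_iteratedDerivWithin_Ici three_pos ht

theorem hasDerivAt_derivWithin (hu : IsTogesVSolution α t₀ f u) (ht : t₀ < t) :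
    HasDerivAt (derivWithin u (Ici t₀)) (iteratedDerivWithin 2 u (Ici t₀) t) t := by
  simpa only [iteratedDerivWithin_one] using
    hu.hasDerivAt_iteratedDerivWithin_Ici (k := 1) (by norm_num) ht

theorem isInertialTrajectory (hu : IsTogesVSolution α t₀ f u) :
    IsInertialTrajectory α (1 / 4) 1 f (fun t => u t + (t / 4) • derivWithin u (Ici t₀) t)
      (fun t => (5 / 4 : ℝ) • derivWithin u (Ici t₀) t
        + (t / 4) • iteratedDerivWithin 2 u (Ici t₀) t) where
  hasDerivAt := by
    filter_upwards [eventually_gt_atTop t₀] with t ht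
    refine ((hu.hasDerivAt ht).add
      (((hasDerivAt_id t).div_const 4).smul (hu.hasDerivAt_derivWithin ht))).congr_deriv ?_
    simp only [id]
    module
  hasDerivAt_velocity := by
    filter_upwards [eventually_gt_atTop t₀, eventually_ne_atTop 0] with t ht ht0
    have hderiv₂ := hu.hasDerivAt_iteratedDerivWithin_Ici (k := 2) (by norm_num) ht
    refine (((hu.hasDerivAt_derivWithin ht).const_smul (5 / 4 : ℝ)).add
      (((hasDerivAt_id t).div_const 4).smul hderiv₂)).congr_deriv ?_
    simp only [id]
    rw [eq_neg_of_add_eq_zero_right (hu.eqn t ht.le)]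
    match_scalars <;> field_simp <;> ring

end IsTogesVSolution

end Reduction

theorem iInf_eq_of_mem_argmin {X : Type*} {f : X → ℝ} {z : X} (hz : z ∈ argmin f) :
    ⨅ x, f x = f z :=
  IsLeast.csInf_eq ⟨mem_range_self z, forall_mem_range.2 fun x => hz (mem_univ x)⟩

theorem theorem2p1 {H : Type*} [NormedAddCommGroup H] [InnerProductSpace ℝ H] [CompleteSpace H]
    (f : H → ℝ) (hconv : ConvexOn ℝ univ f) (hf : ContDiff ℝ 1 f) (hmin : (argmin f).Nonempty)
    (α t₀ : ℝ) (ht₀ : 0 < t₀) (u : ℝ → H) (hu : IsTogesVSolution α t₀ f u) :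
    (3 ≤ α →
      ((fun t : ℝ => f (u t + (t / 4) • derivWithin u (Ici t₀) t) - ⨅ x, f x)
        =O[atTop] fun t : ℝ => 1 / t ^ 3) ∧
      ((fun t : ℝ => f (u t) - ⨅ x, f x) =O[atTop] fun t : ℝ => 1 / t ^ 3)) ∧
    (3 < α →
      ((fun t : ℝ => f (u t + (t / 4) • derivWithin u (Ici t₀) t) - ⨅ x, f x)
        =o[atTop] fun t : ℝ => 1 / t ^ 3) ∧
      ((fun t : ℝ => f (u t) - ⨅ x, f x) =o[atTop] fun t : ℝ => 1 / t ^ 3) ∧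
      ∃ uinf ∈ argmin f, WeaklyConvergesTo u uinf) := by
  obtain ⟨z, hz⟩ := hmin
  have hd : Differentiable ℝ f := hf.differentiable one_ne_zero
  have hfz : ∀ x, f z ≤ f x := fun x => hz (mem_univ x)
  have hu' : ∀ᶠ t in atTop, HasDerivAt u (derivWithin u (Ici t₀) t) t :=
    (eventually_gt_atTop t₀).mono fun t => hu.hasDerivAt
  have hv := hu.isInertialTrajectory
  rw [iInf_eq_of_mem_argmin hz]
  refine ⟨fun hα => ?_, fun hα => ?_⟩
  · have hO := hv.isBigO_value hconv hd (by norm_num) (by push_cast; linarith) hz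
    exact ⟨hO, isBigO_sub_of_extrapolation hu' hconv hd hfz (by norm_num) hO⟩
  · have hα' : ((1 : ℕ) : ℝ) + 2 < α := by push_cast; linarith
    have ho := hv.isLittleO_value hconv hd (by norm_num) hα' hz
    obtain ⟨x, hx, hvx⟩ := hv.exists_weaklyConvergesTo hconv hd (by norm_num) hα' ⟨z, hz⟩
    exact ⟨ho, isLittleO_sub_of_extrapolation hu' hconv hd hfz (by norm_num) ho, x, hx,
      tendsto_toWeakSpace_of_extrapolation hu' four_pos hvx⟩
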